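/- Let $D=(D(t))_{t\ge 0}$ be a real-valued Lévy process (started at $0$, with independent and stationary increments and càdlàg paths) whose sample paths are almost surely strictly increasing, and let $\psi_D$ be its Laplace exponent, given by $\mathbb E[e^{-sD(t)}]=e^{-t\psi_D(s)}$ for all $s,t\ge 0$. Let $$E(t)=\inf\{r>0: D(r)>t\},\qquad t\ge 0,$$ be the inverse of $D$. Let $\lambda>0$ and let $N_1$ be a Poisson process with rate $\lambda$, independent of $D$; that is, $N_1(t)=\max\{n\ge 0: W_1+\cdots+W_n\le t\}$ where the $W_n$ are IID with $\mathbb P(W_n>t)=e^{-\lambda t}$ for $t\ge 0$. Then $N_1(E(t))$ is a renewal process: there are IID, almost surely positive random variables $J_1,J_2,\dots$ such that, almost surely, for all $t\ge 0$, $$N_1(E(t))=\max\{n\ge 0: J_1+\cdots+J_n\le t\}.$$ Moreover, the waiting times $J_n$ satisfy $$\mathbb P(J_n>t)=\mathbb E\big[e^{-\lambda E(t)}\big]\quad\text{for all } n\ge 1,\ t\ge 0,$$ and $$\mathbb E\big[e^{-sJ_n}\big]=\frac{\lambda}{\lambda+\psi_D(s)}\quad\text{for all } n\ge 1,\ s\ge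 0.$$ -/

import Mathlib

open MeasureTheory ProbabilityTheory Filter Topology
open scoped NNReal

/-- A real-valued Lévy process indexed by `[0, ∞)`: it starts at `0`, has independent and
stationary increments, and almost surely has càdlàg paths.  (Stochastic continuity follows from
stationarity of the increments and right-continuity at `0`.) -/
structure IsLevyProcess {Ω : Type*} [MeasurableSpace Ω] (X : ℝ≥0 → Ω → ℝ) (P : Measure Ω) :
    Prop where
  measurable : ∀ t, Measurable (X t)
  zero : ∀ᵐ ω ∂P, X 0 ω = 0
  indep_increments : HasIndepIncrements X P
  stationary_increments : ∀ s h, IdentDistrib (fun ω ↦ X (s + h) ω - X s ω) (X h) P P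
  right_continuous : ∀ᵐ ω ∂P, ∀ t, ContinuousWithinAt (fun r ↦ X r ω) (Set.Ici t) t
  left_limits : ∀ᵐ ω ∂P, ∀ t, ∃ l, Tendsto (fun r ↦ X r ω) (𝓝[<] t) (𝓝 l)

/-- `ψ` is the Laplace exponent of `D` on `[0, ∞)`: `E[exp (-s D(t))] = exp (-t ψ(s))`. -/
def HasLaplaceExponent {Ω : Type*} [MeasurableSpace Ω] (D : ℝ≥0 → Ω → ℝ) (P : Measure Ω)
    (ψ : ℝ → ℝ) : Prop :=
  ∀ s : ℝ, 0 ≤ s → ∀ t : ℝ≥0, ∫ ω, Real.exp (-(s * D t ω)) ∂P = Real.exp (-(t * ψ s))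

/-- The right-continuous inverse (first passage time) `E(t) = inf {r > 0 : D(r) > t}`. -/
noncomputable def firstPassage {Ω : Type*} (D : ℝ≥0 → Ω → ℝ) (t : ℝ≥0) (ω : Ω) : ℝ≥0 :=
  sInf {r : ℝ≥0 | 0 < r ∧ (t : ℝ) < D r ω}

/-- `N` is a renewal process with waiting times `J 0, J 1, …`: these are IID and almost surely
positive, and almost surely, for all `t ≥ 0`, `N(t)` is the largest `n` such that the `n`-th
arrival time `J 0 + ⋯ + J (n - 1)` is at most `t` (in particular, such a largest `n` exists).
The paths of `N` then determine the waiting times almost surely. -/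
structure IsRenewalProcess {Ω : Type*} [MeasurableSpace Ω] (N : ℝ≥0 → Ω → ℕ) (J : ℕ → Ω → ℝ)
    (P : Measure Ω) : Prop where
  indep : iIndepFun J P
  identDistrib : ∀ n, IdentDistrib (J n) (J 0) P P
  pos : ∀ n, ∀ᵐ ω ∂P, 0 < J n ω
  isGreatest : ∀ᵐ ω ∂P, ∀ t : ℝ≥0,
    IsGreatest {n : ℕ | ∑ i ∈ Finset.range n, J i ω ≤ (t : ℝ)} (N t ω)

/-- A Poisson process with rate `lam`: a renewal process whose waiting times are exponential
with parameter `lam`. -/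
def IsPoissonProcess {Ω : Type*} [MeasurableSpace Ω] (lam : ℝ) (N : ℝ≥0 → Ω → ℕ)
    (P : Measure Ω) : Prop :=
  ∃ W : ℕ → Ω → ℝ, IsRenewalProcess N W P ∧ ∀ n, HasLaw (W n) (expMeasure lam) P

open scoped ENNReal

/-!
Let `T_n` be the arrival times of `N`, with waiting times `V_n`. Since `D` is strictly increasing,
unbounded and has almost surely no jump at any `T_n`, the event `T_n ≤ E(t)` is the event
`D(T_n) ≤ t`, for all `n` and `t` simultaneously (`le_firstPassage_iff`). Hence `N(E(t))` counts
the times `D(T_n)` up to `t`, and its waiting times are the increments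
`J_n = D(T_{n+1}) - D(T_n)`.

Only the paths of `N` are assumed independent of `D`, but these paths determine the waiting times
almost surely, so the sequence `V` is independent of `D` (`IsRenewalProcess.indepFun_waiting`).
Conditionally on `V`, independence and stationarity of the increments of `D` make the `J_n`
independent, with `J_n` distributed as `D(v)` for `v = V_n`. Integrating over `V`, the `J_n` are
IID with the law of `D(V_0)` (`IsLevyProcess.measure_inter_arrivalIncrement`). That `D` does not
jump at the `T_n` follows in the same way from the absence of fixed discontinuities
(`IsLevyProcess.ae_tendsto_arrival`).

The two formulas come from conditioning in the two possible orders. Given `D`, the event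
`D(V_0) > t` agrees up to a null set with `V_0 > E(t)`, of probability `exp (-lam * E(t))`. Given
`V_0`, the Laplace transform of `D(V_0)` is `exp (-V_0 * ψ(s))`, whose mean under the exponential
law is `lam / (lam + ψ(s))`.

The evaluation `(t, d) ↦ d t` is not jointly measurable on the space of all paths, so `D` at a
random time is expressed through `pathRightLim`, a limit along grids that is jointly measurable and
agrees with evaluation at right-continuous paths.
-/

/-! ### Evaluating a path at a random time -/

/-- The grid point of mesh `1 / (m + 1)` strictly to the right of `t` that is closest to `t`. -/
noncomputable def gridRight (m : ℕ) (t : ℝ≥0) : ℝ≥0 := (⌊(m + 1) * t⌋₊ + 1 : ℕ) / (m + 1)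

/-- The grid point of mesh `1 / (m + 1)` strictly to the left of `t` that is closest to `t`;
it is `0` for `t = 0`. -/
noncomputable def gridLeft (m : ℕ) (t : ℝ≥0) : ℝ≥0 := (⌈(m + 1) * t⌉₊ - 1 : ℕ) / (m + 1)

lemma lt_gridRight (m : ℕ) (t : ℝ≥0) : t < gridRight m t := by
  rw [gridRight, lt_div_iff₀ (by positivity), mul_comm]
  exact_mod_cast Nat.lt_floor_add_one (((m : ℝ≥0) + 1) * t)

lemma gridRight_le (m : ℕ) (t : ℝ≥0) : gridRight m t ≤ t + 1 / (m + 1) := by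
  rw [gridRight, div_le_iff₀ (by positivity), add_mul t, one_div,
    inv_mul_cancel₀ (by positivity), mul_comm t]
  push_cast
  gcongr
  exact Nat.floor_le (by positivity)

lemma gridLeft_lt (m : ℕ) {t : ℝ≥0} (ht : 0 < t) : gridLeft m t < t := by
  have h : 0 < ⌈((m : ℝ≥0) + 1) * t⌉₊ := Nat.ceil_pos.2 (by positivity)
  rw [gridLeft, div_lt_iff₀' (by positivity)]
  exact Nat.lt_ceil.1 (Nat.sub_lt h one_pos)

lemma le_gridLeft_add (m : ℕ) (t : ℝ≥0) : t ≤ gridLeft m t + 1 / (m + 1) := by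
  rw [gridLeft, ← add_div, le_div_iff₀ (by positivity), mul_comm]
  refine (Nat.le_ceil _).trans ?_
  exact_mod_cast (by omega : ⌈((m : ℝ≥0) + 1) * t⌉₊ ≤ ⌈((m : ℝ≥0) + 1) * t⌉₊ - 1 + 1)

lemma tendsto_gridRight (t : ℝ≥0) : Tendsto (fun m ↦ gridRight m t) atTop (𝓝 t) := by
  refine tendsto_of_tendsto_of_tendsto_of_le_of_le tendsto_const_nhds ?_
    (fun m ↦ (lt_gridRight m t).le) (fun m ↦ gridRight_le m t)
  simpa using (tendsto_const_nhds (x := t)).add (tendsto_one_div_add_atTop_nhds_zero_nat (𝕜 := ℝ≥0))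

lemma tendsto_gridLeft {t : ℝ≥0} (ht : 0 < t) : Tendsto (fun m ↦ gridLeft m t) atTop (𝓝 t) := by
  refine tendsto_of_tendsto_of_tendsto_of_le_of_le ?_ tendsto_const_nhds
    (fun m ↦ tsub_le_iff_right.2 (le_gridLeft_add m t)) (fun m ↦ (gridLeft_lt m ht).le)
  simpa using (tendsto_const_nhds (x := t)).sub (tendsto_one_div_add_atTop_nhds_zero_nat (𝕜 := ℝ≥0))

/-- The right limit at `t` of the path `d`, taken along a grid, as a function of `(t, d)`. Unlike
plain evaluation `d t`, it is jointly measurable for the product `σ`-algebra on path space. -/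
noncomputable def pathRightLim (t : ℝ≥0) (d : ℝ≥0 → ℝ) : ℝ :=
  limUnder atTop (fun m ↦ d (gridRight m t))

lemma measurable_eval_comp {α : Type*} [MeasurableSpace α] (c : ℕ → ℝ≥0) {k : α → ℕ}
    (hk : Measurable k) : Measurable (fun p : α × (ℝ≥0 → ℝ) ↦ p.2 (c (k p.1))) := by
  have h : Measurable (fun p : ℕ × (ℝ≥0 → ℝ) ↦ p.2 (c p.1)) :=
    measurable_from_prod_countable_right (fun n ↦ measurable_pi_apply (c n))
  exact h.comp (f := fun p : α × (ℝ≥0 → ℝ) ↦ (k p.1, p.2)) (by fun_prop)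

lemma measurable_pathRightLim :
    Measurable (fun p : ℝ≥0 × (ℝ≥0 → ℝ) ↦ pathRightLim p.1 p.2) := by
  refine (StronglyMeasurable.limUnder fun m ↦ Measurable.stronglyMeasurable ?_).measurable
  exact measurable_eval_comp (fun k ↦ ((k + 1 : ℕ) : ℝ≥0) / (m + 1))
    (k := fun t ↦ ⌊((m : ℝ≥0) + 1) * t⌋₊) (Nat.measurable_floor.comp (by fun_prop))

lemma pathRightLim_eq {d : ℝ≥0 → ℝ} {t : ℝ≥0} (hd : ContinuousWithinAt d (Set.Ici t) t) :
    pathRightLim t d = d t :=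
  (hd.tendsto.comp (tendsto_nhdsWithin_iff.2 ⟨tendsto_gridRight t,
    .of_forall fun m ↦ (lt_gridRight m t).le⟩)).limUnder_eq

/-! ### Conditioning on an independent variable -/

section Indep

variable {Ω α β : Type*} [MeasurableSpace Ω] [MeasurableSpace α] [MeasurableSpace β]
  {P : Measure Ω} [IsProbabilityMeasure P] {X : Ω → α} {Y : Ω → β}

lemma lintegral_comp_prodMk_of_indepFun (hX : Measurable X) (hY : Measurable Y)
    (h : IndepFun X Y P) {f : α × β → ℝ≥0∞} (hf : Measurable f) :
    ∫⁻ ω, f (X ω, Y ω) ∂P = ∫⁻ ω₁, ∫⁻ ω, f (X ω₁, Y ω) ∂P ∂P := by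
  have := Measure.isProbabilityMeasure_map (μ := P) hX.aemeasurable
  have := Measure.isProbabilityMeasure_map (μ := P) hY.aemeasurable
  rw [← lintegral_map (g := fun ω ↦ (X ω, Y ω)) hf (by fun_prop),
    (indepFun_iff_map_prod_eq_prod_map_map hX.aemeasurable hY.aemeasurable).1 h,
    lintegral_prod _ hf.aemeasurable, lintegral_map (by fun_prop) hX]
  refine lintegral_congr fun ω₁ ↦ ?_
  rw [lintegral_map (by fun_prop) hY]

lemma measure_prodMk_mem_of_indepFun (hX : Measurable X) (hY : Measurable Y)
    (h : IndepFun X Y P) {B : Set (α × β)} (hB : MeasurableSet B) :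
    P {ω | (X ω, Y ω) ∈ B} = ∫⁻ ω₁, P {ω | (X ω₁, Y ω) ∈ B} ∂P := by
  have key := lintegral_comp_prodMk_of_indepFun hX hY h (measurable_one.indicator hB)
  have h1 (ω₁ : Ω) : P {ω | (X ω₁, Y ω) ∈ B} = ∫⁻ ω, B.indicator 1 (X ω₁, Y ω) ∂P := by
    exact (lintegral_indicator_one (hB.preimage (f := fun ω ↦ (X ω₁, Y ω)) (by fun_prop))).symm
  simp_rw [h1, ← key]
  exact (lintegral_indicator_one (hB.preimage (f := fun ω ↦ (X ω, Y ω)) (by fun_prop))).symm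

lemma ae_prodMk_mem_of_indepFun (hX : Measurable X) (hY : Measurable Y)
    (h : IndepFun X Y P) {B : Set (α × β)} (hB : MeasurableSet B)
    (hae : ∀ᵐ ω₁ ∂P, ∀ᵐ ω ∂P, (X ω₁, Y ω) ∈ B) : ∀ᵐ ω ∂P, (X ω, Y ω) ∈ B := by
  change P {ω | (X ω, Y ω) ∈ Bᶜ} = 0
  rw [measure_prodMk_mem_of_indepFun hX hY h hB.compl]
  exact (lintegral_congr_ae (g := 0) (hae.mono fun ω₁ h ↦ h)).trans (by simp)

end Indep

/-! ### Path properties of Lévy processes -/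

section Levy

variable {Ω : Type*} [MeasurableSpace Ω] {P : Measure Ω} [IsProbabilityMeasure P]
  {D : ℝ≥0 → Ω → ℝ}

/-- A Lévy process has no fixed discontinuities. -/
lemma IsLevyProcess.ae_tendsto_of_tendsto_left (hD : IsLevyProcess D P) {t : ℝ≥0} {s : ℕ → ℝ≥0}
    (hst : ∀ m, s m < t) (hs : Tendsto s atTop (𝓝 t)) :
    ∀ᵐ ω ∂P, Tendsto (fun m ↦ D (s m) ω) atTop (𝓝 (D t ω)) := by
  have h0 : Tendsto (fun m ↦ t - s m) atTop (𝓝[≥] 0) := by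
    refine tendsto_nhdsWithin_iff.2 ⟨?_, .of_forall fun m ↦ zero_le (a := t - s m)⟩
    simpa using (tendsto_const_nhds (x := t)).sub hs
  have h1 : TendstoInMeasure P (fun m ω ↦ D (t - s m) ω) atTop (fun _ ↦ (0 : ℝ)) := by
    refine tendstoInMeasure_of_tendsto_ae (fun m ↦ (hD.measurable _).aestronglyMeasurable) ?_
    filter_upwards [hD.zero, hD.right_continuous] with ω hz hr
    simpa [hz, Function.comp_def] using (hr 0).tendsto.comp h0
  -- stationarity turns the convergence at `0` into convergence in measure at `t`
  have h2 : TendstoInMeasure P (fun m ω ↦ D t ω - D (s m) ω) atTop (fun _ ↦ (0 : ℝ)) := by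
    rw [tendstoInMeasure_iff_norm] at h1 ⊢
    intro ε hε
    refine (h1 ε hε).congr fun m ↦ ?_
    have hid := hD.stationary_increments (s m) (t - s m)
    rw [add_tsub_cancel_of_le (hst m).le] at hid
    exact (hid.measure_mem_eq (s := {x | ε ≤ ‖x - 0‖})
      (measurableSet_le measurable_const (by fun_prop))).symm
  obtain ⟨ns, hns, hae⟩ := h2.exists_seq_tendsto_ae
  filter_upwards [hae, hD.left_limits] with ω h3 h4
  obtain ⟨l, hl⟩ := h4 t
  have h5 : Tendsto (fun m ↦ D (s m) ω) atTop (𝓝 l) :=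
    hl.comp (tendsto_nhdsWithin_iff.2 ⟨hs, .of_forall hst⟩)
  have h6 := (tendsto_const_nhds (x := D t ω)).sub (h5.comp hns.tendsto_atTop)
  rwa [← sub_eq_zero.1 (tendsto_nhds_unique h6 h3)] at h5

/-- A strictly increasing Lévy process tends to infinity: `E[exp (-D(n))]` is the `n`-th power of
`E[exp (-D(1))] < 1`. -/
lemma IsLevyProcess.ae_exists_lt (hD : IsLevyProcess D P)
    (hmono : ∀ᵐ ω ∂P, StrictMono (fun t ↦ D t ω)) :
    ∀ᵐ ω ∂P, ∀ K : ℝ, ∃ n : ℕ, K < D n ω := by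
  set q : ℝ≥0∞ := ∫⁻ ω, ENNReal.ofReal (Real.exp (-D 1 ω)) ∂P with hq
  have hm : ∀ t, Measurable (D t) := hD.measurable
  have hq1 : q < 1 := by
    have hlt : ∀ᵐ ω ∂P, ENNReal.ofReal (Real.exp (-D 1 ω)) < 1 := by
      filter_upwards [hmono, hD.zero] with ω h h0
      have h1 : D 0 ω < D 1 ω := h zero_lt_one
      rw [← ENNReal.ofReal_one]
      exact (ENNReal.ofReal_lt_ofReal_iff one_pos).2 (Real.exp_lt_one_iff.2 (by linarith))
    have := lintegral_strict_mono (μ := P) (IsProbabilityMeasure.ne_zero P)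
      (g := fun _ ↦ (1 : ℝ≥0∞)) aemeasurable_const
      (f := fun ω ↦ ENNReal.ofReal (Real.exp (-D 1 ω)))
      (ne_top_of_le_ne_top (by simp) (lintegral_mono_ae (hlt.mono fun _ h ↦ h.le))) hlt
    simpa using this
  have hpow (n : ℕ) : ∫⁻ ω, ENNReal.ofReal (Real.exp (-D n ω)) ∂P = q ^ n := by
    have hind := (hD.indep_increments.nat (t := fun i ↦ (i : ℝ≥0)) Nat.mono_cast).comp
      (fun _ x ↦ ENNReal.ofReal (Real.exp (-x))) (fun _ ↦ by fun_prop)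
    have h1 := lintegral_prod_eq_prod_lintegral_of_indepFun (Finset.range n) _ hind
      (fun i ↦ by
        have := hm ((i + 1 : ℕ) : ℝ≥0); have := hm (i : ℝ≥0)
        simp only [Function.comp_def]; fun_prop)
    have h2 (i : ℕ) : ∫⁻ ω, ENNReal.ofReal (Real.exp (-(D ((i + 1 : ℕ) : ℝ≥0) ω - D i ω))) ∂P
        = q := by
      have := (hD.stationary_increments i 1).comp (u := fun x ↦ ENNReal.ofReal (Real.exp (-x)))
        (by fun_prop)
      simpa [Function.comp_def] using this.lintegral_eq
    simp only [Function.comp_def, h2, Finset.prod_const, Finset.card_range] at h1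
    rw [← h1]
    refine lintegral_congr_ae ?_
    filter_upwards [hD.zero] with ω h0
    rw [← ENNReal.ofReal_prod_of_nonneg (fun _ _ ↦ (Real.exp_pos _).le), ← Real.exp_sum,
      Finset.sum_neg_distrib, Finset.sum_range_sub (fun i ↦ D (i : ℕ) ω)]
    simp [h0]
  have hK (K : ℕ) : ∀ᵐ ω ∂P, ∃ n : ℕ, (K : ℝ) < D n ω := by
    have hb (n : ℕ) : P {ω | ¬ ∃ n : ℕ, (K : ℝ) < D n ω} ≤ ENNReal.ofReal (Real.exp K) * q ^ n := by
      rw [← hpow, ← lintegral_const_mul _ (by have := hm n; fun_prop)]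
      refine le_trans ?_ (meas_le_lintegral₀ (s := {ω | ¬ ∃ n : ℕ, (K : ℝ) < D n ω})
        (by have := hm n; fun_prop) fun ω hω ↦ ?_)
      · exact le_rfl
      · have h : D n ω ≤ K := by
          by_contra! h
          exact hω ⟨n, h⟩
        rw [← ENNReal.ofReal_mul (Real.exp_pos _).le, ← Real.exp_add, ← ENNReal.ofReal_one]
        exact ENNReal.ofReal_le_ofReal (Real.one_le_exp (by linarith))
    have hlim : Tendsto (fun n ↦ ENNReal.ofReal (Real.exp K) * q ^ n) atTop (𝓝 0) := by
      simpa using ENNReal.Tendsto.const_mul (ENNReal.tendsto_pow_atTop_nhds_zero_of_lt_one hq1)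
        (Or.inr ENNReal.ofReal_ne_top)
    exact le_antisymm (ge_of_tendsto' hlim hb) zero_le
  filter_upwards [ae_all_iff.2 hK] with ω h K
  obtain ⟨k, hk⟩ := exists_nat_gt K
  obtain ⟨n, hn⟩ := h k
  exact ⟨n, hk.trans hn⟩

end Levy

/-! ### First passage times of strictly increasing paths -/

section FirstPassage

variable {Ω : Type*} {D : ℝ≥0 → Ω → ℝ} {ω : Ω} {t x : ℝ≥0}

lemma lt_of_firstPassage_lt (hmono : StrictMono (fun t ↦ D t ω))
    (hunb : ∀ K : ℝ, ∃ n : ℕ, K < D n ω) (h : firstPassage D t ω < x) : (t : ℝ) < D x ω := by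
  obtain ⟨n, hn⟩ := hunb t
  -- the index `0` has to be avoided in the definition of the first passage time
  have hne : {r : ℝ≥0 | 0 < r ∧ (t : ℝ) < D r ω}.Nonempty :=
    ⟨n + 1, by positivity, hn.trans (hmono (lt_add_one (n : ℝ≥0)))⟩
  obtain ⟨r, hr, hrx⟩ := exists_lt_of_csInf_lt hne h
  exact hr.2.trans (hmono hrx)

lemma le_of_lt_firstPassage (h0 : D 0 ω = 0) (h : x < firstPassage D t ω) : D x ω ≤ t := by
  by_contra! hx
  have hpos : 0 < x := by
    refine pos_iff_ne_zero.2 fun h ↦ ?_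
    rw [h, h0] at hx
    exact absurd hx (not_lt.2 t.coe_nonneg)
  exact absurd h (not_lt.2 (csInf_le (OrderBot.bddBelow _) ⟨hpos, hx⟩))

/-- At a time `x` without a jump from the left, `E(t) ≥ x` if and only if `D(x) ≤ t`. -/
lemma le_firstPassage_iff (h0 : D 0 ω = 0) (hmono : StrictMono (fun t ↦ D t ω))
    (hunb : ∀ K : ℝ, ∃ n : ℕ, K < D n ω) {s : ℕ → ℝ≥0} (hs : 0 < x → ∀ m, s m < x)
    (hlim : 0 < x → Tendsto (fun m ↦ D (s m) ω) atTop (𝓝 (D x ω))) :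
    x ≤ firstPassage D t ω ↔ D x ω ≤ t := by
  constructor
  · intro h
    rcases (zero_le (a := x)).eq_or_lt with rfl | hx
    · simp [h0]
    · exact le_of_tendsto' (hlim hx) fun m ↦ le_of_lt_firstPassage h0 ((hs hx m).trans_le h)
  · intro h
    by_contra! hx
    exact absurd (lt_of_firstPassage_lt hmono hunb hx) (not_lt.2 h)

end FirstPassage

/-! ### The exponential distribution -/

lemma expMeasure_singleton (lam x : ℝ) : expMeasure lam {x} = 0 :=
  withDensity_absolutelyContinuous _ _ (by simp)

lemma expMeasure_Ioi {lam : ℝ} (hlam : 0 < lam) {x : ℝ} (hx : 0 ≤ x) :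
    expMeasure lam (Set.Ioi x) = ENNReal.ofReal (Real.exp (-(lam * x))) := by
  have := isProbabilityMeasure_expMeasure hlam
  have h := cdf_expMeasure_eq hlam x
  rw [cdf_eq_real, if_pos hx] at h
  rw [← Set.compl_Iic, ← ofReal_measureReal, probReal_compl_eq_one_sub measurableSet_Iic, h]
  congr 1
  ring

lemma ae_pos_expMeasure {lam : ℝ} (hlam : 0 < lam) : ∀ᵐ x ∂expMeasure lam, 0 < x := by
  have := isProbabilityMeasure_expMeasure hlam
  exact (mem_ae_iff_prob_eq_one measurableSet_Ioi).2
    ((expMeasure_Ioi hlam le_rfl).trans (by simp))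

lemma lintegral_exp_neg_mul_expMeasure {lam c : ℝ} (hlam : 0 < lam) (hc : 0 ≤ c) :
    ∫⁻ x, ENNReal.ofReal (Real.exp (-(x * c))) ∂expMeasure lam
      = ENNReal.ofReal (lam / (lam + c)) := by
  have hm (r : ℝ) : Measurable (exponentialPDF r) :=
    (measurable_exponentialPDFReal r).ennreal_ofReal
  change ∫⁻ x, _ ∂(volume.withDensity (exponentialPDF lam)) = _
  rw [lintegral_withDensity_eq_lintegral_mul _ (hm lam) (by fun_prop)]
  -- up to a constant, the integrand is the density of the exponential law with rate `lam + c`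
  have h (x : ℝ) : (exponentialPDF lam * fun x ↦ ENNReal.ofReal (Real.exp (-(x * c)))) x
      = ENNReal.ofReal (lam / (lam + c)) * exponentialPDF (lam + c) x := by
    rcases lt_or_ge x 0 with hx | hx
    · simp [exponentialPDF_of_neg hx]
    · rw [Pi.mul_apply, exponentialPDF_of_nonneg hx, exponentialPDF_of_nonneg hx,
        ← ENNReal.ofReal_mul (by positivity), ← ENNReal.ofReal_mul (by positivity), mul_assoc,
        ← Real.exp_add, ← mul_assoc, div_mul_cancel₀ _ (by positivity)]
      congr 3
      ring
  simp_rw [h]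
  rw [lintegral_const_mul _ (hm _), lintegral_exponentialPDF_eq_one (by positivity), mul_one]

/-! ### Waiting times as functionals of the renewal path -/

/-- The first rational time at which the path `N` reaches level `k`, as a measurable function on
path space with its product `σ`-algebra. -/
noncomputable def levelTime (k : ℕ) (N : ℝ≥0 → ℕ) : ℝ≥0∞ :=
  ⨅ q : ℚ, if k ≤ N (q : ℝ).toNNReal then ((q : ℝ).toNNReal : ℝ≥0∞) else ⊤

lemma measurable_levelTime (k : ℕ) : Measurable (levelTime k) := by
  refine Measurable.iInf fun q ↦ Measurable.ite ?_ measurable_const measurable_const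
  exact measurableSet_le measurable_const (measurable_pi_apply _)

/-- The level times of a renewal path are its arrival times. -/
lemma levelTime_eq {w : ℕ → ℝ} (hw : ∀ i, 0 < w i) {N : ℝ≥0 → ℕ}
    (hN : ∀ t : ℝ≥0, IsGreatest {n : ℕ | ∑ i ∈ Finset.range n, w i ≤ (t : ℝ)} (N t)) (k : ℕ) :
    levelTime k N = ENNReal.ofReal (∑ i ∈ Finset.range k, w i) := by
  have hiff (t : ℝ≥0) : k ≤ N t ↔ ENNReal.ofReal (∑ i ∈ Finset.range k, w i) ≤ t := by
    rw [ENNReal.ofReal_le_coe]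
    refine ⟨fun h ↦ le_trans ?_ (hN t).1, fun h ↦ (hN t).2 h⟩
    exact Finset.sum_le_sum_of_subset_of_nonneg (Finset.range_subset_range.2 h)
      fun i _ _ ↦ (hw i).le
  refine le_antisymm (le_of_forall_gt fun b hb ↦ ?_) (le_iInf fun q ↦ ?_)
  · obtain ⟨q, -, h1, h2⟩ := ENNReal.lt_iff_exists_rat_btwn.1 hb
    refine (iInf_le _ q).trans_lt ?_
    rwa [if_pos ((hiff _).2 h1.le)]
  · split_ifs with h
    · exact (hiff _).1 h
    · exact le_top

/-- The waiting times of a renewal process independent of `Y` are jointly independent of `Y`, since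
they are almost surely determined by the path. -/
lemma IsRenewalProcess.indepFun_waiting {Ω β : Type*} [MeasurableSpace Ω] [MeasurableSpace β]
    {P : Measure Ω} {N : ℝ≥0 → Ω → ℕ} {W : ℕ → Ω → ℝ} (hN : IsRenewalProcess N W P) {Y : Ω → β}
    (h : IndepFun (fun ω t ↦ N t ω) Y P) : IndepFun (fun ω i ↦ W i ω) Y P := by
  have hg : Measurable (fun (n : ℝ≥0 → ℕ) (i : ℕ) ↦
      (levelTime (i + 1) n).toReal - (levelTime i n).toReal) :=
    measurable_pi_lambda _ fun i ↦
      (measurable_levelTime _).ennreal_toReal.sub (measurable_levelTime _).ennreal_toReal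
  refine (h.comp hg measurable_id).congr ?_ .rfl
  filter_upwards [ae_all_iff.2 hN.pos, hN.isGreatest] with ω hpos hgr
  funext i
  have hnn (k : ℕ) : 0 ≤ ∑ i ∈ Finset.range k, W i ω := Finset.sum_nonneg fun i _ ↦ (hpos i).le
  simp only [Function.comp_apply, levelTime_eq (w := fun i ↦ W i ω) hpos hgr,
    ENNReal.toReal_ofReal (hnn _)]
  rw [Finset.sum_range_succ, add_sub_cancel_left]

/-! ### Increments of a Lévy process over independent waiting times -/

/-- The `n`-th arrival time for the waiting times `v`, as a nonnegative real (negative partial sums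
are truncated to `0`). -/
noncomputable def arrival (v : ℕ → ℝ) (n : ℕ) : ℝ≥0 := (∑ i ∈ Finset.range n, v i).toNNReal

lemma measurable_arrival (n : ℕ) : Measurable (fun v ↦ arrival v n) := by
  unfold arrival
  fun_prop

lemma arrival_succ {v : ℕ → ℝ} (hv : ∀ i, 0 < v i) (n : ℕ) :
    arrival v (n + 1) = arrival v n + (v n).toNNReal := by
  rw [arrival, Finset.sum_range_succ,
    Real.toNNReal_add (Finset.sum_nonneg fun i _ ↦ (hv i).le) (hv n).le, arrival]

lemma arrival_strictMono {v : ℕ → ℝ} (hv : ∀ i, 0 < v i) : StrictMono (arrival v) :=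
  strictMono_nat_of_lt_succ fun n ↦ by
    rw [arrival_succ hv]
    exact lt_add_of_pos_right _ (Real.toNNReal_pos.2 (hv n))

/-- The increment of the path `d` over the `n`-th waiting interval of `v`. -/
noncomputable def arrivalIncrement (n : ℕ) (v : ℕ → ℝ) (d : ℝ≥0 → ℝ) : ℝ :=
  pathRightLim (arrival v (n + 1)) d - pathRightLim (arrival v n) d

lemma measurable_arrivalIncrement (n : ℕ) :
    Measurable (fun p : (ℕ → ℝ) × (ℝ≥0 → ℝ) ↦ arrivalIncrement n p.1 p.2) := by
  have h (k : ℕ) : Measurable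
      (fun p : (ℕ → ℝ) × (ℝ≥0 → ℝ) ↦ pathRightLim (arrival p.1 k) p.2) :=
    measurable_pathRightLim.comp
      (((measurable_arrival k).comp measurable_fst).prodMk measurable_snd)
  exact (h _).sub (h _)

lemma arrivalIncrement_eq {d : ℝ≥0 → ℝ} (hd : ∀ t, ContinuousWithinAt d (Set.Ici t) t) (n : ℕ)
    (v : ℕ → ℝ) : arrivalIncrement n v d = d (arrival v (n + 1)) - d (arrival v n) := by
  rw [arrivalIncrement, pathRightLim_eq (hd _), pathRightLim_eq (hd _)]

section Levy

variable {Ω : Type*} [MeasurableSpace Ω] {P : Measure Ω} [IsProbabilityMeasure P]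
  {D : ℝ≥0 → Ω → ℝ} {V : ℕ → Ω → ℝ}

/-- Conditionally on the waiting times, the increments of `D` over the waiting intervals are
independent, and the `i`-th of them is distributed as `D` at time `V i`. -/
lemma IsLevyProcess.measure_inter_arrivalIncrement (hD : IsLevyProcess D P)
    (hVm : ∀ i, Measurable (V i)) (hVi : iIndepFun V P) (hVpos : ∀ i, ∀ᵐ ω ∂P, 0 < V i ω)
    (hVD : IndepFun (fun ω i ↦ V i ω) (fun ω t ↦ D t ω) P) (S : Finset ℕ) {A : ℕ → Set ℝ}
    (hA : ∀ i ∈ S, MeasurableSet (A i)) :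
    P (⋂ i ∈ S, (fun ω ↦ arrivalIncrement i (V · ω) (D · ω)) ⁻¹' A i)
      = ∏ i ∈ S, ∫⁻ ω₁, P {ω | pathRightLim (V i ω₁).toNNReal (D · ω) ∈ A i} ∂P := by
  have hV : Measurable (fun ω i ↦ V i ω) := measurable_pi_lambda _ hVm
  have hDm : Measurable (fun ω t ↦ D t ω) := measurable_pi_lambda _ hD.measurable
  have hB : MeasurableSet {p : (ℕ → ℝ) × (ℝ≥0 → ℝ) | ∀ i ∈ S, arrivalIncrement i p.1 p.2 ∈ A i} := by
    simp only [Set.ofPred_forall]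
    exact Finset.measurableSet_biInter _ fun i hi ↦ measurable_arrivalIncrement i (hA i hi)
  have h1 := measure_prodMk_mem_of_indepFun hV hDm hVD hB
  have h2 : ∀ᵐ ω₁ ∂P, P {ω | ∀ i ∈ S, arrivalIncrement i (V · ω₁) (D · ω) ∈ A i}
      = ∏ i ∈ S, P {ω | pathRightLim (V i ω₁).toNNReal (D · ω) ∈ A i} := by
    filter_upwards [ae_all_iff.2 hVpos] with ω₁ hpos
    set T : ℕ → ℝ≥0 := arrival (V · ω₁)
    have hTm : Monotone T := (arrival_strictMono hpos).monotone
    calc P {ω | ∀ i ∈ S, arrivalIncrement i (V · ω₁) (D · ω) ∈ A i}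
        = P (⋂ i ∈ S, (fun ω ↦ D (T (i + 1)) ω - D (T i) ω) ⁻¹' A i) := by
          refine measure_congr ?_
          filter_upwards [hD.right_continuous] with ω hω
          refine propext ?_
          change (∀ i ∈ S, _) ↔ ω ∈ ⋂ i ∈ S, _
          simp [arrivalIncrement_eq hω, T]
      _ = ∏ i ∈ S, P ((fun ω ↦ D (T (i + 1)) ω - D (T i) ω) ⁻¹' A i) :=
          (hD.indep_increments.nat hTm).measure_inter_preimage_eq_mul S hA
      _ = ∏ i ∈ S, P {ω | pathRightLim (V i ω₁).toNNReal (D · ω) ∈ A i} := by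
          refine Finset.prod_congr rfl fun i hi ↦ ?_
          have hst := hD.stationary_increments (T i) (V i ω₁).toNNReal
          rw [← arrival_succ hpos i] at hst
          rw [hst.measure_mem_eq (hA i hi)]
          refine measure_congr ?_
          filter_upwards [hD.right_continuous] with ω hω
          refine propext ?_
          change D _ ω ∈ A i ↔ pathRightLim _ _ ∈ A i
          rw [pathRightLim_eq (hω _)]
  have h3 (i : ℕ) (hi : i ∈ S) :
      Measurable (fun x : ℝ ↦ P {ω | pathRightLim x.toNNReal (D · ω) ∈ A i}) := by
    have hm : Measurable (fun p : ℝ × Ω ↦ pathRightLim p.1.toNNReal (D · p.2)) :=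
      measurable_pathRightLim.comp
        ((measurable_real_toNNReal.comp measurable_fst).prodMk (hDm.comp measurable_snd))
    exact measurable_measure_prodMk_left (hm (hA i hi))
  have h4 : (⋂ i ∈ S, (fun ω ↦ arrivalIncrement i (V · ω) (D · ω)) ⁻¹' A i)
      = {ω | ∀ i ∈ S, arrivalIncrement i (V · ω) (D · ω) ∈ A i} := by
    ext ω
    simp
  rw [h4]
  refine h1.trans ((lintegral_congr_ae h2).trans ?_)
  -- extend the factors from `S` to all indices by constants
  classical
  have h5 : ∀ i, Measurable (fun x : ℝ ↦
      if i ∈ S then P {ω | pathRightLim x.toNNReal (D · ω) ∈ A i} else 0) := fun i ↦ by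
    by_cases hi : i ∈ S
    · simpa [hi] using h3 i hi
    · simp [hi]
  have h6 := lintegral_prod_eq_prod_lintegral_of_indepFun S _ (hVi.comp _ h5)
    fun i ↦ (h5 i).comp (hVm i)
  calc _ = ∫⁻ ω₁, ∏ i ∈ S, (((fun x : ℝ ↦
        if i ∈ S then P {ω | pathRightLim x.toNNReal (D · ω) ∈ A i} else 0)) ∘ V i) ω₁ ∂P := by
        refine lintegral_congr fun ω₁ ↦ Finset.prod_congr rfl fun i hi ↦ ?_
        simp [hi]
    _ = _ := h6
    _ = _ := by
        refine Finset.prod_congr rfl fun i hi ↦ lintegral_congr fun ω₁ ↦ ?_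
        simp [hi]

lemma measurable_arrivalIncrement_comp (hVm : ∀ i, Measurable (V i)) (hDm : ∀ t, Measurable (D t))
    (n : ℕ) : Measurable (fun ω ↦ arrivalIncrement n (V · ω) (D · ω)) :=
  (measurable_arrivalIncrement n).comp (f := fun ω ↦ (fun i ↦ V i ω, fun t ↦ D t ω))
    ((measurable_pi_lambda _ hVm).prodMk (measurable_pi_lambda _ hDm))

lemma IsLevyProcess.measure_arrivalIncrement (hD : IsLevyProcess D P)
    (hVm : ∀ i, Measurable (V i)) (hVi : iIndepFun V P) (hVpos : ∀ i, ∀ᵐ ω ∂P, 0 < V i ω)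
    (hVD : IndepFun (fun ω i ↦ V i ω) (fun ω t ↦ D t ω) P) (n : ℕ) {A : Set ℝ}
    (hA : MeasurableSet A) :
    P ((fun ω ↦ arrivalIncrement n (V · ω) (D · ω)) ⁻¹' A)
      = ∫⁻ ω₁, P {ω | pathRightLim (V n ω₁).toNNReal (D · ω) ∈ A} ∂P := by
  simpa using hD.measure_inter_arrivalIncrement hVm hVi hVpos hVD {n} (A := fun _ ↦ A)
    fun _ _ ↦ hA

lemma IsLevyProcess.iIndepFun_arrivalIncrement (hD : IsLevyProcess D P)
    (hVm : ∀ i, Measurable (V i)) (hVi : iIndepFun V P) (hVpos : ∀ i, ∀ᵐ ω ∂P, 0 < V i ω)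
    (hVD : IndepFun (fun ω i ↦ V i ω) (fun ω t ↦ D t ω) P) :
    iIndepFun (fun n ω ↦ arrivalIncrement n (V · ω) (D · ω)) P := by
  refine iIndepFun_iff_measure_inter_preimage_eq_mul.2 fun S A hA ↦ ?_
  rw [hD.measure_inter_arrivalIncrement hVm hVi hVpos hVD S hA]
  exact Finset.prod_congr rfl fun i hi ↦
    (hD.measure_arrivalIncrement hVm hVi hVpos hVD i (hA i hi)).symm

/-- The increments over the waiting intervals are distributed as `D` evaluated at the independent
time `V 0`. -/
lemma IsLevyProcess.identDistrib_arrivalIncrement (hD : IsLevyProcess D P)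
    (hVm : ∀ i, Measurable (V i)) (hVi : iIndepFun V P) (hVpos : ∀ i, ∀ᵐ ω ∂P, 0 < V i ω)
    (hVD : IndepFun (fun ω i ↦ V i ω) (fun ω t ↦ D t ω) P)
    (hVid : ∀ i, IdentDistrib (V i) (V 0) P P) (n : ℕ) :
    IdentDistrib (fun ω ↦ arrivalIncrement n (V · ω) (D · ω))
      (fun ω ↦ pathRightLim (V 0 ω).toNNReal (D · ω)) P P := by
  have hDm : Measurable (fun ω t ↦ D t ω) := measurable_pi_lambda _ hD.measurable
  have hJ := measurable_arrivalIncrement_comp hVm hD.measurable n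
  have hR : Measurable (fun p : ℝ × (ℝ≥0 → ℝ) ↦ pathRightLim p.1.toNNReal p.2) :=
    measurable_pathRightLim.comp
      ((measurable_real_toNNReal.comp measurable_fst).prodMk measurable_snd)
  have hR0 : Measurable (fun ω ↦ pathRightLim (V 0 ω).toNNReal (D · ω)) :=
    hR.comp (f := fun ω ↦ (V 0 ω, fun t ↦ D t ω)) ((hVm 0).prodMk hDm)
  refine ⟨hJ.aemeasurable, hR0.aemeasurable, ?_⟩
  ext A hA
  have h0 : IndepFun (V 0) (fun ω t ↦ D t ω) P := hVD.comp (measurable_pi_apply 0) measurable_id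
  have h3 : Measurable (fun x : ℝ ↦ P {ω | pathRightLim x.toNNReal (D · ω) ∈ A}) := by
    have hm := hR.comp (measurable_fst.prodMk (hDm.comp measurable_snd) :
      Measurable (fun p : ℝ × Ω ↦ (p.1, fun t ↦ D t p.2)))
    exact measurable_measure_prodMk_left (hm hA)
  rw [Measure.map_apply hJ hA, Measure.map_apply hR0 hA,
    hD.measure_arrivalIncrement hVm hVi hVpos hVD n hA]
  exact ((hVid n).comp h3).lintegral_eq.trans
    (measure_prodMk_mem_of_indepFun (hVm 0) hDm h0 (hR hA)).symm

/-- Almost surely, a Lévy process has no jump at any of the independent times `arrival V n`. -/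
lemma IsLevyProcess.ae_tendsto_arrival (hD : IsLevyProcess D P) (hVm : ∀ i, Measurable (V i))
    (hVD : IndepFun (fun ω i ↦ V i ω) (fun ω t ↦ D t ω) P) :
    ∀ᵐ ω ∂P, ∀ n, 0 < arrival (V · ω) n → Tendsto
      (fun m ↦ D (gridLeft m (arrival (V · ω) n)) ω) atTop (𝓝 (D (arrival (V · ω) n) ω)) := by
  refine ae_all_iff.2 fun n ↦ ?_
  have hV : Measurable (fun ω i ↦ V i ω) := measurable_pi_lambda _ hVm
  have hDm : Measurable (fun ω t ↦ D t ω) := measurable_pi_lambda _ hD.measurable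
  have hgrid (m : ℕ) : Measurable
      (fun p : (ℕ → ℝ) × (ℝ≥0 → ℝ) ↦ p.2 (gridLeft m (arrival p.1 n))) :=
    measurable_eval_comp (fun k ↦ ((k - 1 : ℕ) : ℝ≥0) / (m + 1))
      (k := fun v ↦ ⌈((m : ℝ≥0) + 1) * arrival v n⌉₊)
      (Nat.measurable_ceil.comp ((measurable_arrival n).const_mul _))
  have hlim : Measurable (fun p : (ℕ → ℝ) × (ℝ≥0 → ℝ) ↦ pathRightLim (arrival p.1 n) p.2) :=
    measurable_pathRightLim.comp
      (((measurable_arrival n).comp measurable_fst).prodMk measurable_snd)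
  have hpos : MeasurableSet {p : (ℕ → ℝ) × (ℝ≥0 → ℝ) | 0 < arrival p.1 n} :=
    measurableSet_lt measurable_const ((measurable_arrival n).comp measurable_fst)
  have key := ae_prodMk_mem_of_indepFun hV hDm hVD
    (hpos.compl.union (measurableSet_tendsto_fun (l := atTop) hgrid hlim)) (.of_forall fun ω₁ ↦ ?_)
  · filter_upwards [key, hD.right_continuous] with ω h hω hT
    have h1 := h.resolve_left (not_not.2 hT)
    rwa [Set.mem_ofPred_eq, pathRightLim_eq (hω _)] at h1
  · rcases (zero_le (a := arrival (V · ω₁) n)).eq_or_lt with h0 | hT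
    · exact .of_forall fun ω ↦ Or.inl (not_lt.2 h0.ge)
    · filter_upwards [hD.right_continuous, hD.ae_tendsto_of_tendsto_left
        (fun m ↦ gridLeft_lt m hT) (tendsto_gridLeft hT)] with ω hω h
      refine Or.inr ?_
      rwa [Set.mem_ofPred_eq, pathRightLim_eq (hω _)]

end Levy

/-! ### A Lévy process at an independent exponential time -/

lemma HasLaplaceExponent.lintegral_eq {Ω : Type*} [MeasurableSpace Ω] {P : Measure Ω}
    {D : ℝ≥0 → Ω → ℝ} {ψ : ℝ → ℝ} (hψ : HasLaplaceExponent D P ψ) {s : ℝ} (hs : 0 ≤ s) (t : ℝ≥0) :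
    ∫⁻ ω, ENNReal.ofReal (Real.exp (-(s * D t ω))) ∂P = ENNReal.ofReal (Real.exp (-(t * ψ s))) := by
  -- a nonzero Bochner integral forces integrability
  have hi : Integrable (fun ω ↦ Real.exp (-(s * D t ω))) P := by
    by_contra h
    have h1 := hψ s hs t
    rw [integral_undef h] at h1
    exact (Real.exp_pos _).ne h1
  rw [← hψ s hs t, ofReal_integral_eq_lintegral_ofReal hi (.of_forall fun _ ↦ (Real.exp_pos _).le)]

section ExponentialTime

variable {Ω : Type*} [MeasurableSpace Ω] {P : Measure Ω} [IsProbabilityMeasure P]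
  {D : ℝ≥0 → Ω → ℝ} {X : Ω → ℝ} {lam : ℝ}

lemma measurable_pathRightLim_toNNReal :
    Measurable (fun p : ℝ × (ℝ≥0 → ℝ) ↦ pathRightLim p.1.toNNReal p.2) :=
  measurable_pathRightLim.comp
    ((measurable_real_toNNReal.comp measurable_fst).prodMk measurable_snd)

/-- For a fixed path of `D`, the events `D(X) > t` and `X > E(t)` differ only on `X = E(t)`, which
has probability zero for an exponential time `X`. -/
lemma IsLevyProcess.ae_measure_lt_eq_exp_firstPassage (hD : IsLevyProcess D P)
    (hmono : ∀ᵐ ω ∂P, StrictMono (fun t ↦ D t ω)) (hlam : 0 < lam)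
    (hX : HasLaw X (expMeasure lam) P) (t : ℝ≥0) :
    ∀ᵐ ω ∂P, P {ω₁ | (t : ℝ) < pathRightLim (X ω₁).toNNReal (D · ω)}
      = ENNReal.ofReal (Real.exp (-(lam * firstPassage D t ω))) := by
  filter_upwards [hD.right_continuous, hmono, hD.zero, hD.ae_exists_lt hmono] with ω hr hm h0 hu
  set e := firstPassage D t ω with he
  have hpos : ∀ᵐ ω₁ ∂P, 0 < X ω₁ := ae_of_ae_map hX.aemeasurable (by
    rw [hX.map_eq]
    exact ae_pos_expMeasure hlam)
  have hne : ∀ᵐ ω₁ ∂P, X ω₁ ≠ e := by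
    change P (_)ᶜ = 0
    have := hX.measure_eq (p := fun x ↦ x = (e : ℝ)) (measurableSet_singleton _)
    simpa [Set.compl_def] using this.trans (expMeasure_singleton lam e)
  rw [← expMeasure_Ioi hlam e.coe_nonneg]
  refine Eq.trans ?_ (hX.measure_eq (p := fun x ↦ (e : ℝ) < x) measurableSet_Ioi)
  refine measure_congr ?_
  filter_upwards [hpos, hne] with ω₁ h1 h2
  refine propext ?_
  change (t : ℝ) < pathRightLim _ _ ↔ (e : ℝ) < X ω₁
  rw [pathRightLim_eq (hr _)]
  constructor
  · intro h
    refine lt_of_le_of_ne (not_lt.1 fun h3 ↦ ?_) h2.symm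
    exact absurd h (not_lt.2 (le_of_lt_firstPassage h0
      ((Real.toNNReal_lt_iff_lt_coe h1.le).2 h3)))
  · intro h
    exact lt_of_firstPassage_lt hm hu (Real.lt_toNNReal_iff_coe_lt.2 h)

lemma IsLevyProcess.integrable_exp_firstPassage (hD : IsLevyProcess D P)
    (hmono : ∀ᵐ ω ∂P, StrictMono (fun t ↦ D t ω)) (hlam : 0 < lam) (hXm : Measurable X)
    (hX : HasLaw X (expMeasure lam) P) (t : ℝ≥0) :
    Integrable (fun ω ↦ Real.exp (-(lam * firstPassage D t ω))) P := by
  have hDm : Measurable (fun ω t ↦ D t ω) := measurable_pi_lambda _ hD.measurable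
  have hm : Measurable (fun ω ↦ P {ω₁ | (t : ℝ) < pathRightLim (X ω₁).toNNReal (D · ω)}) := by
    have h := measurable_pathRightLim_toNNReal.comp
      (f := fun p : Ω × Ω ↦ (X p.2, fun t ↦ D t p.1))
      ((hXm.comp measurable_snd).prodMk (hDm.comp measurable_fst))
    exact measurable_measure_prodMk_left (h measurableSet_Ioi)
  refine Integrable.of_bound (C := 1) ?_ (.of_forall fun ω ↦ ?_)
  · refine (hm.ennreal_toReal.aemeasurable.congr ?_).aestronglyMeasurable
    filter_upwards [hD.ae_measure_lt_eq_exp_firstPassage hmono hlam hX t] with ω h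
    rw [h, ENNReal.toReal_ofReal (Real.exp_pos _).le]
  · rw [Real.norm_of_nonneg (Real.exp_pos _).le, Real.exp_le_one_iff, neg_nonpos]
    positivity

lemma IsLevyProcess.measureReal_lt_exponentialTime (hD : IsLevyProcess D P)
    (hmono : ∀ᵐ ω ∂P, StrictMono (fun t ↦ D t ω)) (hlam : 0 < lam) (hXm : Measurable X)
    (hX : HasLaw X (expMeasure lam) P) (hXD : IndepFun X (fun ω t ↦ D t ω) P) (t : ℝ≥0) :
    P.real {ω | (t : ℝ) < pathRightLim (X ω).toNNReal (D · ω)}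
      = ∫ ω, Real.exp (-(lam * firstPassage D t ω)) ∂P := by
  have hDm : Measurable (fun ω t ↦ D t ω) := measurable_pi_lambda _ hD.measurable
  have hB : MeasurableSet {p : (ℝ≥0 → ℝ) × ℝ | (t : ℝ) < pathRightLim p.2.toNNReal p.1} :=
    (measurable_pathRightLim_toNNReal.comp measurable_swap) measurableSet_Ioi
  rw [integral_eq_lintegral_of_nonneg_ae (.of_forall fun _ ↦ (Real.exp_pos _).le)
    (hD.integrable_exp_firstPassage hmono hlam hXm hX t).aestronglyMeasurable, Measure.real]
  congr 1
  exact (measure_prodMk_mem_of_indepFun hDm hXm hXD.symm hB).trans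
    (lintegral_congr_ae (hD.ae_measure_lt_eq_exp_firstPassage hmono hlam hX t))

lemma HasLaplaceExponent.nonneg {ψ : ℝ → ℝ} (hψ : HasLaplaceExponent D P ψ)
    (hpos : ∀ᵐ ω ∂P, 0 ≤ D 1 ω) {s : ℝ} (hs : 0 ≤ s) : 0 ≤ ψ s := by
  have h1 : ∫ ω, Real.exp (-(s * D 1 ω)) ∂P ≤ ∫ _, (1 : ℝ) ∂P := by
    refine integral_mono_of_nonneg (.of_forall fun _ ↦ (Real.exp_pos _).le)
      (integrable_const _) ?_
    filter_upwards [hpos] with ω h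
    exact Real.exp_le_one_iff.2 (neg_nonpos.2 (mul_nonneg hs h))
  simpa [hψ s hs 1] using h1

lemma IsLevyProcess.integral_exp_exponentialTime (hD : IsLevyProcess D P)
    (hmono : ∀ᵐ ω ∂P, StrictMono (fun t ↦ D t ω)) (hlam : 0 < lam) (hXm : Measurable X)
    (hX : HasLaw X (expMeasure lam) P) (hXD : IndepFun X (fun ω t ↦ D t ω) P) {ψ : ℝ → ℝ}
    (hψ : HasLaplaceExponent D P ψ) {s : ℝ} (hs : 0 ≤ s) :
    ∫ ω, Real.exp (-(s * pathRightLim (X ω).toNNReal (D · ω))) ∂P = lam / (lam + ψ s) := by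
  have hDm : Measurable (fun ω t ↦ D t ω) := measurable_pi_lambda _ hD.measurable
  have hψs : 0 ≤ ψ s := hψ.nonneg (by
    filter_upwards [hmono, hD.zero] with ω h h0
    exact h0.symm.le.trans (h.monotone zero_le_one)) hs
  have hR : Measurable (fun ω ↦ pathRightLim (X ω).toNNReal (D · ω)) :=
    measurable_pathRightLim_toNNReal.comp (f := fun ω ↦ (X ω, fun t ↦ D t ω)) (hXm.prodMk hDm)
  have hR' : Measurable (fun ω ↦ Real.exp (-(s * pathRightLim (X ω).toNNReal (D · ω)))) :=
    Real.measurable_exp.comp (hR.const_mul s).neg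
  have hf : Measurable (fun p : ℝ × (ℝ≥0 → ℝ) ↦
      ENNReal.ofReal (Real.exp (-(s * pathRightLim p.1.toNNReal p.2)))) :=
    (Real.measurable_exp.comp (measurable_pathRightLim_toNNReal.const_mul s).neg).ennreal_ofReal
  have hpos : ∀ᵐ ω₁ ∂P, 0 < X ω₁ := ae_of_ae_map hX.aemeasurable (by
    rw [hX.map_eq]
    exact ae_pos_expMeasure hlam)
  rw [integral_eq_lintegral_of_nonneg_ae (.of_forall fun _ ↦ (Real.exp_pos _).le)
    hR'.aestronglyMeasurable,
    ← ENNReal.toReal_ofReal (r := lam / (lam + ψ s)) (by positivity)]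
  congr 1
  calc _ = ∫⁻ ω₁, ∫⁻ ω, ENNReal.ofReal
          (Real.exp (-(s * pathRightLim (X ω₁).toNNReal (D · ω)))) ∂P ∂P :=
        lintegral_comp_prodMk_of_indepFun hXm hDm hXD hf
    _ = ∫⁻ ω₁, ENNReal.ofReal (Real.exp (-(X ω₁ * ψ s))) ∂P := by
        refine lintegral_congr_ae ?_
        filter_upwards [hpos] with ω₁ h
        have h1 := hψ.lintegral_eq hs (X ω₁).toNNReal
        rw [Real.coe_toNNReal _ h.le] at h1
        rw [← h1]
        refine lintegral_congr_ae ?_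
        filter_upwards [hD.right_continuous] with ω hr
        rw [pathRightLim_eq (hr _)]
    _ = ∫⁻ x, ENNReal.ofReal (Real.exp (-(x * ψ s))) ∂expMeasure lam := by
        rw [← hX.map_eq, lintegral_map (by fun_prop) hXm]
    _ = _ := lintegral_exp_neg_mul_expMeasure hlam hψs

end ExponentialTime

/-! ### The time-changed Poisson process -/

theorem theorem4p1 {Ω : Type*} [MeasurableSpace Ω] (P : Measure Ω) [IsProbabilityMeasure P]
    (D : ℝ≥0 → Ω → ℝ) (hD : IsLevyProcess D P)
    (hD_mono : ∀ᵐ ω ∂P, StrictMono (fun t ↦ D t ω))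
    (lam : ℝ) (hlam : 0 < lam)
    (N : ℝ≥0 → Ω → ℕ) (hN : IsPoissonProcess lam N P)
    (hND : IndepFun (fun ω t ↦ N t ω) (fun ω t ↦ D t ω) P) :
    ∃ J : ℕ → Ω → ℝ,
      IsRenewalProcess (fun t ω ↦ N (firstPassage D t ω) ω) J P ∧
      (∀ t : ℝ≥0, Integrable (fun ω ↦ Real.exp (-(lam * firstPassage D t ω))) P) ∧
      (∀ (n : ℕ) (t : ℝ≥0), P.real {ω | (t : ℝ) < J n ω} =
        ∫ ω, Real.exp (-(lam * firstPassage D t ω)) ∂P) ∧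
      ∀ ψ : ℝ → ℝ, HasLaplaceExponent D P ψ → ∀ (n : ℕ) (s : ℝ), 0 ≤ s →
        ∫ ω, Real.exp (-(s * J n ω)) ∂P = lam / (lam + ψ s) := by
  obtain ⟨W, hW, hlaw⟩ := hN
  -- the waiting times are only almost everywhere measurable
  obtain ⟨V, hVm, hWV⟩ : ∃ V : ℕ → Ω → ℝ, (∀ i, Measurable (V i)) ∧ ∀ i, W i =ᵐ[P] V i :=
    ⟨fun i ↦ (hlaw i).aemeasurable.mk, fun i ↦ (hlaw i).aemeasurable.measurable_mk,
      fun i ↦ (hlaw i).aemeasurable.ae_eq_mk⟩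
  have hVlaw (i : ℕ) : HasLaw (V i) (expMeasure lam) P := (hlaw i).congr (hWV i).symm
  have hVi : iIndepFun V P := hW.indep.congr hWV
  have hVpos (i : ℕ) : ∀ᵐ ω ∂P, 0 < V i ω := by
    filter_upwards [hW.pos i, hWV i] with ω h h1 using h1 ▸ h
  have hVid (i : ℕ) : IdentDistrib (V i) (V 0) P P :=
    ⟨(hVm i).aemeasurable, (hVm 0).aemeasurable, by rw [(hVlaw i).map_eq, (hVlaw 0).map_eq]⟩
  have hVD : IndepFun (fun ω i ↦ V i ω) (fun ω t ↦ D t ω) P := by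
    refine (hW.indepFun_waiting hND).congr ?_ .rfl
    filter_upwards [ae_all_iff.2 hWV] with ω h using funext h
  have h0D : IndepFun (V 0) (fun ω t ↦ D t ω) P :=
    hVD.comp (measurable_pi_apply 0) measurable_id
  have hid := hD.identDistrib_arrivalIncrement hVm hVi hVpos hVD hVid
  refine ⟨fun n ω ↦ arrivalIncrement n (V · ω) (D · ω), ⟨?_, ?_, ?_, ?_⟩, ?_, ?_, ?_⟩
  · exact hD.iIndepFun_arrivalIncrement hVm hVi hVpos hVD
  · exact fun n ↦ (hid n).trans (hid 0).symm
  · intro n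
    filter_upwards [ae_all_iff.2 hVpos, hD_mono, hD.right_continuous] with ω hpos hm hr
    rw [arrivalIncrement_eq hr, sub_pos]
    exact hm (arrival_strictMono hpos n.lt_succ_self)
  · filter_upwards [ae_all_iff.2 hVpos, hD_mono, hD.right_continuous, hD.zero,
      hD.ae_exists_lt hD_mono, hD.ae_tendsto_arrival hVm hVD, ae_all_iff.2 hWV, hW.isGreatest]
      with ω hpos hm hr h0 hu htend hWV hgr t
    convert hgr (firstPassage D t ω) using 1
    ext n
    simp only [Set.mem_ofPred_eq, arrivalIncrement_eq hr, hWV]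
    -- the arrival times of the time-changed process are `D` at the arrival times of `N`
    rw [Finset.sum_range_sub (fun i ↦ D (arrival (V · ω) i) ω),
      ← Real.toNNReal_le_iff_le_coe (r := ∑ i ∈ Finset.range n, V i ω)]
    have h00 : arrival (V · ω) 0 = 0 := by simp [arrival]
    rw [h00, h0, sub_zero]
    exact (le_firstPassage_iff h0 hm hu (fun h m ↦ gridLeft_lt m h) (htend n)).symm
  · exact hD.integrable_exp_firstPassage hD_mono hlam (hVm 0) (hVlaw 0)
  · intro n t
    rw [← hD.measureReal_lt_exponentialTime hD_mono hlam (hVm 0) (hVlaw 0) h0D t]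
    exact congrArg ENNReal.toReal ((hid n).measure_mem_eq measurableSet_Ioi)
  · intro ψ hψ n s hs
    rw [← hD.integral_exp_exponentialTime hD_mono hlam (hVm 0) (hVlaw 0) h0D hψ hs]
    exact ((hid n).comp (u := fun x ↦ Real.exp (-(s * x))) (by fun_prop)).integral_eq
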